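/- Let $n\ge 1$, let $\Omega\subset\mathbb R^n$ be a bounded open set (for instance a bounded Lipschitz domain), let $\Xi$ be a separable real Banach space, and let $a:\Omega\times\Xi\to\mathbb R$ and $0<a_*\le a^*<\infty$ be given. Let $H^1_0(\Omega)$ be the closure of $C_c^\infty(\Omega)$ in the norm $\|u\|_{H^1}=(\|u\|_{L^2}^2+\|\nabla u\|_{L^2}^2)^{1/2}$. For $\eta\in\Xi$ such that $a(\cdot,\eta)$ is measurable and $$a_*\le a(x,\eta)\le a^*\quad\text{for almost every }x\in\Omega, \tag{1}$$ and for $\zeta\in L^2(\Omega)$, let $s(\eta,\zeta)\in H^1_0(\Omega)$ denote the unique weak solution of $-\nabla\cdot(a(\cdot,\eta)\nabla u)=\zeta$ in $\Omega$, $u=0$ on $\partial\Omega$, that is, the unique $u\in H_0^1(\Omega)$ with $$\int_\Omega a(x,\eta)\,\nabla u(x)\cdot\nabla v(x)\,dx=\int_\Omega \zeta(x)\,v(x)\,dx\qquad\text{for all } v\in H^1_0(\Omega).$$ **Proposition 4.3.** Let $(z_\epsilon)_{\epsilon>0}\subset L^2(\Omega)$ and $z\in L^2(\Omega)$ with $z_\epsilon\rightharpoonup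 z$ weakly in $L^2(\Omega)$ as $\epsilon\downarrow0$, and let $(\xi_\epsilon)_{\epsilon>0}\subset\Xi$ and $\xi\in\Xi$ with $\xi_\epsilon\to\xi$ in $\Xi$ as $\epsilon\downarrow 0$. Assume that, with the same constants $a_*,a^*$, the function $a(\cdot,\eta)$ is measurable and (1) holds for $\eta=\xi$ and for $\eta=\xi_\epsilon$, for every $\epsilon>0$. Assume that $a(x,\cdot):\Xi\to\mathbb R$ is sequentially continuous for almost every $x\in\Omega$. Then the weak solutions $s(\xi,z)$ and $s(\xi_\epsilon,z_\epsilon)$, $\epsilon>0$, exist and are unique, and $$s(\xi_\epsilon,z_\epsilon)\to s(\xi,z)\quad\text{strongly in } H^1_0(\Omega)\text{ as }\epsilon\downarrow0 .$$ -/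

import Mathlib

open Set Filter Topology MeasureTheory
open scoped ENNReal ContDiff

noncomputable section

namespace EllipticPDE

/-- `L²(Ω)`, with respect to Lebesgue measure on `Ω ⊆ ℝⁿ`. -/
abbrev L2 {n : ℕ} (Ω : Set (EuclideanSpace ℝ (Fin n))) : Type :=
  Lp ℝ 2 (volume.restrict Ω)

/-- `L²(Ω; ℝⁿ)`. -/
abbrev L2Vec {n : ℕ} (Ω : Set (EuclideanSpace ℝ (Fin n))) : Type :=
  Lp (EuclideanSpace ℝ (Fin n)) 2 (volume.restrict Ω)

/-- The Hilbert space `L²(Ω) × L²(Ω; ℝⁿ)` with `‖(u, G)‖² = ‖u‖² + ‖G‖²`. A Sobolev function `u` is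
represented in it by the pair `(u, ∇u)`, so the inherited norm is the usual `H¹` norm. -/
abbrev PairSpace {n : ℕ} (Ω : Set (EuclideanSpace ℝ (Fin n))) : Type :=
  WithLp 2 (L2 Ω × L2Vec Ω)

/-- `φ ∈ C_c^∞(Ω)`. -/
structure IsTest {n : ℕ} (Ω : Set (EuclideanSpace ℝ (Fin n)))
    (φ : EuclideanSpace ℝ (Fin n) → ℝ) : Prop where
  contDiff : ContDiff ℝ ∞ φ
  hasCompactSupport : HasCompactSupport φ
  tsupport_subset : tsupport φ ⊆ Ω

/-- `G` is the weak gradient of `u` on `Ω`: `∫_Ω u ∂_i φ = - ∫_Ω G_i φ` for every test function `φ`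
and every direction `i`. -/
def IsWeakGradient {n : ℕ} (Ω : Set (EuclideanSpace ℝ (Fin n))) (u : L2 Ω) (G : L2Vec Ω) : Prop :=
  ∀ φ : EuclideanSpace ℝ (Fin n) → ℝ, IsTest Ω φ → ∀ i : Fin n,
    ∫ x in Ω, u x * gradient φ x i = - ∫ x in Ω, G x i * φ x

/-- The pairs `(φ, ∇φ)` with `φ ∈ C_c^∞(Ω)`. -/
def testPairs {n : ℕ} (Ω : Set (EuclideanSpace ℝ (Fin n))) : Submodule ℝ (PairSpace Ω) where
  carrier := {p | ∃ φ : EuclideanSpace ℝ (Fin n) → ℝ, IsTest Ω φ ∧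
    p.fst =ᵐ[volume.restrict Ω] φ ∧ p.snd =ᵐ[volume.restrict Ω] gradient φ}
  zero_mem' := by
    refine ⟨fun _ => 0, ⟨contDiff_const, HasCompactSupport.zero, by simp [tsupport]⟩, ?_, ?_⟩
    · exact Lp.coeFn_zero _ _ _
    · refine (Lp.coeFn_zero _ _ _).trans (Eventually.of_forall fun x => ?_)
      simp [gradient]
  add_mem' := by
    rintro p q ⟨φ, hφ, hp1, hp2⟩ ⟨ψ, hψ, hq1, hq2⟩
    refine ⟨φ + ψ, ⟨hφ.1.add hψ.1, hφ.2.add hψ.2, (tsupport_add φ ψ).trans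
      (union_subset hφ.3 hψ.3)⟩, ?_, ?_⟩
    · filter_upwards [Lp.coeFn_add p.fst q.fst, hp1, hq1] with x h h1 h2
      simpa [h1, h2] using h
    · filter_upwards [Lp.coeFn_add p.snd q.snd, hp2, hq2] with x h h1 h2
      have e : gradient (φ + ψ) x = gradient φ x + gradient ψ x := by
        simp only [gradient]
        rw [fderiv_add (hφ.1.differentiable (by simp) x) (hψ.1.differentiable (by simp) x), map_add]
      rw [e, ← h1, ← h2]
      simpa using h
  smul_mem' := by
    rintro c p ⟨φ, hφ, hp1, hp2⟩
    refine ⟨c • φ, ⟨contDiff_const.smul hφ.1, hφ.2.smul_left (f := fun _ => c),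
      (tsupport_smul_subset_right (fun _ => c) φ).trans hφ.3⟩, ?_, ?_⟩
    · filter_upwards [Lp.coeFn_smul c p.fst, hp1] with x h h1
      simpa [h1] using h
    · filter_upwards [Lp.coeFn_smul c p.snd, hp2] with x h h1
      have e : gradient (c • φ) x = c • gradient φ x := by
        simp only [gradient]
        rw [fderiv_const_smul (hφ.1.differentiable (by simp) x), map_smulₛₗ]
        simp
      rw [e, ← h1]
      simpa using h

theorem IsTest.memLp {n : ℕ} {Ω : Set (EuclideanSpace ℝ (Fin n))}
    {φ : EuclideanSpace ℝ (Fin n) → ℝ} (h : IsTest Ω φ) : MemLp φ 2 (volume.restrict Ω) :=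
  (h.1.continuous.memLp_of_hasCompactSupport h.2).restrict Ω

theorem IsTest.gradient_apply {n : ℕ} (φ : EuclideanSpace ℝ (Fin n) → ℝ)
    (x : EuclideanSpace ℝ (Fin n)) (i : Fin n) :
    gradient φ x i = fderiv ℝ φ x (EuclideanSpace.single i 1) := by
  have := InnerProductSpace.toDual_symm_apply (𝕜 := ℝ) (x := EuclideanSpace.single i (1 : ℝ))
    (y := fderiv ℝ φ x)
  rw [← this, gradient, EuclideanSpace.inner_single_right]
  simp

theorem IsTest.isTest_partial {n : ℕ} {Ω : Set (EuclideanSpace ℝ (Fin n))}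
    {φ : EuclideanSpace ℝ (Fin n) → ℝ} (h : IsTest Ω φ) (i : Fin n) :
    IsTest Ω (fun x => gradient φ x i) := by
  simp only [IsTest.gradient_apply]
  exact ⟨(h.1.fderiv_right (m := ∞) (by simp)).clm_apply contDiff_const,
    h.2.fderiv_apply ℝ _, (tsupport_fderiv_apply_subset ℝ _).trans h.3⟩

theorem isWeakGradient_of_mem_testPairs {n : ℕ} {Ω : Set (EuclideanSpace ℝ (Fin n))}
    {p : PairSpace Ω} (hp : p ∈ testPairs Ω) : IsWeakGradient Ω p.fst p.snd := by
  obtain ⟨ψ, hψ, h1, h2⟩ := hp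
  intro φ hφ i
  have e1 : ∫ x in Ω, p.fst x * gradient φ x i = ∫ x in Ω, ψ x * gradient φ x i :=
    integral_congr_ae (by filter_upwards [h1] with x hx; rw [hx])
  have e2 : ∫ x in Ω, p.snd x i * φ x = ∫ x in Ω, gradient ψ x i * φ x :=
    integral_congr_ae (by filter_upwards [h2] with x hx; rw [hx])
  have z : ∀ {f : EuclideanSpace ℝ (Fin n) → ℝ}, IsTest Ω f → ∀ x, x ∉ Ω → f x = 0 :=
    fun hf x hx => image_eq_zero_of_notMem_tsupport fun h => hx (hf.3 h)
  rw [e1, e2, setIntegral_eq_integral_of_forall_compl_eq_zero (fun x hx => by simp [z hψ x hx]),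
    setIntegral_eq_integral_of_forall_compl_eq_zero (fun x hx => by simp [z hφ x hx])]
  have int : ∀ {f g : EuclideanSpace ℝ (Fin n) → ℝ}, IsTest Ω f → IsTest Ω g →
      Integrable (fun x => f x * g x) := fun hf hg =>
    (hf.1.continuous.mul hg.1.continuous).integrable_of_hasCompactSupport hf.2.mul_right
  have a1 := int (hψ.isTest_partial i) hφ
  have a2 := int hψ (hφ.isTest_partial i)
  have a3 := int hψ hφ
  simp only [IsTest.gradient_apply] at a1 a2 ⊢
  exact integral_mul_fderiv_eq_neg_fderiv_mul_of_integrable a1 a2 a3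
    (fun x _ => hψ.1.differentiable (by simp) x) (fun x _ => hφ.1.differentiable (by simp) x)

/-- `H¹₀(Ω)`: the closure of `C_c^∞(Ω)` in the `H¹` norm. An element `u` is stored together with its
weak gradient (see `isWeakGradient_of_mem_H10`): the function is `u.1.fst`, its gradient is
`u.1.snd`, and the norm is `(‖u‖²_{L²} + ‖∇u‖²_{L²})^{1/2}`. -/
def H10 {n : ℕ} (Ω : Set (EuclideanSpace ℝ (Fin n))) : Submodule ℝ (PairSpace Ω) :=
  (testPairs Ω).topologicalClosure

theorem isWeakGradient_of_mem_H10 {n : ℕ} {Ω : Set (EuclideanSpace ℝ (Fin n))}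
    {p : PairSpace Ω} (hp : p ∈ H10 Ω) : IsWeakGradient Ω p.fst p.snd := by
  intro φ hφ i
  have m1 := (hφ.isTest_partial i).memLp
  have m2 : MemLp (fun x => φ x • EuclideanSpace.single i (1 : ℝ)) 2 (volume.restrict Ω) := by
    refine Continuous.memLp_of_hasCompactSupport ?_ ?_ |>.restrict Ω
    · exact hφ.1.continuous.smul continuous_const
    · exact hφ.2.smul_right
  have e1 : ∀ q : PairSpace Ω, ∫ x in Ω, q.fst x * gradient φ x i = inner ℝ (m1.toLp _) q.fst := by
    intro q
    rw [L2.inner_def]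
    refine integral_congr_ae ?_
    filter_upwards [m1.coeFn_toLp] with x hx
    rw [hx]; simp
  have e2 : ∀ q : PairSpace Ω, ∫ x in Ω, q.snd x i * φ x = inner ℝ (m2.toLp _) q.snd := by
    intro q
    rw [L2.inner_def]
    refine integral_congr_ae ?_
    filter_upwards [m2.coeFn_toLp] with x hx
    rw [hx, inner_smul_left, EuclideanSpace.inner_single_left]
    simp [mul_comm]
  have c : IsClosed {q : PairSpace Ω | inner ℝ (m1.toLp _) q.fst = - inner ℝ (m2.toLp _) q.snd} :=
    isClosed_eq (continuous_const.inner (WithLp.fstL 2 ℝ (L2 Ω) (L2Vec Ω)).continuous)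
      (continuous_const.inner (WithLp.sndL 2 ℝ (L2 Ω) (L2Vec Ω)).continuous).neg
  have := closure_minimal (fun q hq => by
    have := isWeakGradient_of_mem_testPairs hq φ hφ i
    rwa [e1, e2] at this) c hp
  rw [e1, e2]
  exact this

/-- The function underlying an element of `H¹₀(Ω)`. -/
def H10.toL2 {n : ℕ} {Ω : Set (EuclideanSpace ℝ (Fin n))} (u : H10 Ω) : L2 Ω := u.1.fst

/-- The weak gradient of an element of `H¹₀(Ω)`. -/
def H10.grad {n : ℕ} {Ω : Set (EuclideanSpace ℝ (Fin n))} (u : H10 Ω) : L2Vec Ω := u.1.snd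

/-- `u ∈ H¹₀(Ω)` is a weak solution of `-∇ · (A ∇u) = z` in `Ω`, `u = 0` on `∂Ω`:
`∫_Ω A ∇u · ∇v = ∫_Ω z v` for all `v ∈ H¹₀(Ω)`. -/
def IsWeakSolution {n : ℕ} (Ω : Set (EuclideanSpace ℝ (Fin n)))
    (A : EuclideanSpace ℝ (Fin n) → ℝ) (z : L2 Ω) (u : H10 Ω) : Prop :=
  ∀ v : H10 Ω, ∫ x in Ω, A x * inner ℝ (H10.grad u x) (H10.grad v x) = ∫ x in Ω, z x * H10.toL2 v x

open Classical in
/-- The solution operator `s(ξ, z)` for the coefficient `a(x, ξ)`: the unique weak solution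
(and `0`, a value without meaning, if there is no unique weak solution). -/
def solutionOp {n : ℕ} {Ξ : Type*} (Ω : Set (EuclideanSpace ℝ (Fin n)))
    (a : EuclideanSpace ℝ (Fin n) → Ξ → ℝ) (ξ : Ξ) (z : L2 Ω) : H10 Ω :=
  if h : ∃! u : H10 Ω, IsWeakSolution Ω (fun x => a x ξ) z u then h.choose else 0

/-- The coefficient `A = a(·, ξ)` is (a.e.-)measurable and `lo ≤ A ≤ hi` a.e. in `Ω`. -/
structure BoundedCoercive {n : ℕ} (Ω : Set (EuclideanSpace ℝ (Fin n))) (lo hi : ℝ)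
    (A : EuclideanSpace ℝ (Fin n) → ℝ) : Prop where
  aemeasurable : AEMeasurable A (volume.restrict Ω)
  bounds : ∀ᵐ x ∂(volume.restrict Ω), lo ≤ A x ∧ A x ≤ hi

end EllipticPDE

end

/-!
Let `u` and `u'` be the weak solutions for the data `(A, z)` and `(A', z')`. Testing both equations
with `w = u' - u` gives the energy estimate

`lo ‖∇w‖² ≤ |⟨z' - z, w⟩| + ‖(A' - A) ∇u‖ ‖w‖`   (`le_of_isWeakSolution`),

and `‖w‖` is controlled by `‖∇w‖` because of the Poincaré inequality (`poincare_testPairs`), which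
also yields existence and uniqueness by the Lax–Milgram theorem (`existsUnique_isWeakSolution`).
Along a sequence of parameters, `(A' - A) ∇u → 0` in `L²` by dominated convergence (`tendsto_mulL`),
so it remains to see that weak convergence `z' ⇀ z` in `L²(Ω)` implies convergence in the dual norm
of `H¹₀(Ω)` (`eventually_abs_inner_toL2_le`).

This last fact is usually deduced from the Rellich compactness theorem. Here it is obtained directly
from the estimate

`|⟨g, φ⟩| ≤ δ ‖g‖ ‖∇φ‖ + |B(0, δ)|⁻¹ ‖w ↦ ∫_{Ω ∩ B(w, δ)} g‖ ‖φ‖`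
(`abs_inner_le_of_mem_testPairs`),

which compares `φ` with its mean over translates by `y ∈ B(0, δ)`: each translate costs
`|y| ‖g‖ ‖∇φ‖`, and by Fubini the mean can be moved onto `g`. If `g ⇀ 0` weakly, then the ball
averages of `g` tend to `0` pointwise and boundedly, hence in `L²(Ω)` since `Ω` is bounded, while
`‖g‖` stays bounded; then `δ` is chosen small.
-/

namespace EllipticPDE

variable {n : ℕ} {Ω : Set (EuclideanSpace ℝ (Fin n))} {lo hi : ℝ}
  {A : EuclideanSpace ℝ (Fin n) → ℝ}

/-! ### Multiplication by the coefficient -/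

theorem BoundedCoercive.abs_le (h : BoundedCoercive Ω lo hi A) :
    ∀ᵐ x ∂(volume.restrict Ω), |A x| ≤ max |lo| |hi| := by
  filter_upwards [h.bounds] with x hx
  exact abs_le_max_abs_abs hx.1 hx.2

theorem BoundedCoercive.ae_norm_smul_le (h : BoundedCoercive Ω lo hi A) (F : L2Vec Ω) :
    ∀ᵐ x ∂(volume.restrict Ω), ‖A x • F x‖ ≤ max |lo| |hi| * ‖F x‖ := by
  filter_upwards [h.abs_le] with x hx
  rw [norm_smul, Real.norm_eq_abs]
  gcongr

theorem BoundedCoercive.memLp_smul (h : BoundedCoercive Ω lo hi A) (F : L2Vec Ω) :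
    MemLp (fun x => A x • F x) 2 (volume.restrict Ω) :=
  (Lp.memLp F).of_le_mul (h.aemeasurable.aestronglyMeasurable.smul (Lp.aestronglyMeasurable F))
    (h.ae_norm_smul_le F)

/-- Multiplication by a bounded coefficient, as a bounded operator on `L²(Ω; ℝⁿ)`. -/
noncomputable def BoundedCoercive.mulL (h : BoundedCoercive Ω lo hi A) : L2Vec Ω →L[ℝ] L2Vec Ω :=
  LinearMap.mkContinuous
    { toFun := fun F => (h.memLp_smul F).toLp
      map_add' := fun F G => by
        ext1
        filter_upwards [(h.memLp_smul (F + G)).coeFn_toLp, (h.memLp_smul F).coeFn_toLp,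
          (h.memLp_smul G).coeFn_toLp, Lp.coeFn_add F G,
          Lp.coeFn_add (h.memLp_smul F).toLp (h.memLp_smul G).toLp] with x h1 h2 h3 h4 h5
        rw [h1, h5, h4, Pi.add_apply, Pi.add_apply, h2, h3, smul_add]
      map_smul' := fun c F => by
        ext1
        filter_upwards [(h.memLp_smul (c • F)).coeFn_toLp, (h.memLp_smul F).coeFn_toLp,
          Lp.coeFn_smul c F, Lp.coeFn_smul c (h.memLp_smul F).toLp] with x h1 h2 h3 h4
        rw [h1, RingHom.id_apply, h4, h3, Pi.smul_apply, Pi.smul_apply, h2, smul_comm] }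
    (max |lo| |hi|) fun F => by
      refine Lp.norm_le_mul_norm_of_ae_le_mul ?_
      filter_upwards [(h.memLp_smul F).coeFn_toLp, h.ae_norm_smul_le F] with x h1 h2
      exact (congrArg norm h1).trans_le h2

theorem BoundedCoercive.coeFn_mulL (h : BoundedCoercive Ω lo hi A) (F : L2Vec Ω) :
    h.mulL F =ᵐ[volume.restrict Ω] fun x => A x • F x :=
  (h.memLp_smul F).coeFn_toLp

theorem BoundedCoercive.inner_mulL (h : BoundedCoercive Ω lo hi A) (F G : L2Vec Ω) :
    inner ℝ (h.mulL F) G = ∫ x in Ω, A x * inner ℝ (F x) (G x) := by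
  rw [L2.inner_def]
  refine integral_congr_ae ?_
  filter_upwards [h.coeFn_mulL F] with x hx
  rw [hx, real_inner_smul_left]

theorem BoundedCoercive.le_inner_mulL (h : BoundedCoercive Ω lo hi A) (F : L2Vec Ω) :
    lo * ‖F‖ ^ 2 ≤ inner ℝ (h.mulL F) F := by
  rw [← real_inner_self_eq_norm_sq, L2.inner_def, ← integral_const_mul, L2.inner_def]
  refine integral_mono_ae ((L2.integrable_inner F F).const_mul lo)
    (L2.integrable_inner (h.mulL F) F) ?_
  filter_upwards [h.bounds, h.coeFn_mulL F] with x hx h1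
  simp only [h1, real_inner_smul_left]
  exact mul_le_mul_of_nonneg_right hx.1 real_inner_self_nonneg

/-- Uniformly bounded coefficients that converge almost everywhere converge strongly as
multiplication operators. -/
theorem tendsto_mulL {B : ℕ → EuclideanSpace ℝ (Fin n) → ℝ}
    (hB : ∀ k, BoundedCoercive Ω lo hi (B k)) (hA : BoundedCoercive Ω lo hi A)
    (h : ∀ᵐ x ∂(volume.restrict Ω), Tendsto (fun k => B k x) atTop (𝓝 (A x))) (F : L2Vec Ω) :
    Tendsto (fun k => (hB k).mulL F) atTop (𝓝 (hA.mulL F)) := by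
  set C := max |lo| |hi|
  rw [tendsto_iff_norm_sub_tendsto_zero]
  have key : Tendsto (fun k => ‖(hB k).mulL F - hA.mulL F‖ ^ 2) atTop (𝓝 0) := by
    have e : ∀ k, ‖(hB k).mulL F - hA.mulL F‖ ^ 2
        = ∫ x in Ω, (B k x - A x) ^ 2 * ‖F x‖ ^ 2 := by
      intro k
      rw [← real_inner_self_eq_norm_sq, L2.inner_def]
      refine integral_congr_ae ?_
      filter_upwards [(hB k).coeFn_mulL F, hA.coeFn_mulL F,
        Lp.coeFn_sub ((hB k).mulL F) (hA.mulL F)] with x h1 h2 h3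
      rw [h3, Pi.sub_apply, h1, h2, ← sub_smul, real_inner_self_eq_norm_sq, norm_smul, mul_pow,
        Real.norm_eq_abs, sq_abs]
    simp_rw [e]
    have hF : Integrable (fun x => ‖F x‖ ^ 2) (volume.restrict Ω) := by
      simpa only [real_inner_self_eq_norm_sq] using L2.integrable_inner (𝕜 := ℝ) F F
    have := tendsto_integral_of_dominated_convergence (μ := volume.restrict Ω)
      (F := fun k x => (B k x - A x) ^ 2 * ‖F x‖ ^ 2) (f := fun _ => (0 : ℝ))
      (fun x => (C + C) ^ 2 * ‖F x‖ ^ 2)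
      (fun k => ((((hB k).aemeasurable.sub hA.aemeasurable).pow_const 2).aestronglyMeasurable).mul
        hF.aestronglyMeasurable) (hF.const_mul _)
      (fun k => by
        filter_upwards [(hB k).abs_le, hA.abs_le] with x h1 h2
        rw [Real.norm_eq_abs, abs_mul, abs_pow, abs_of_nonneg (sq_nonneg ‖F x‖)]
        have := (abs_sub (B k x) (A x)).trans (add_le_add h1 h2)
        gcongr)
      (by
        filter_upwards [h] with x hx
        simpa using ((hx.sub_const (A x)).pow 2).mul_const (‖F x‖ ^ 2))
    simpa using this
  have := key.sqrt
  simpa using this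

/-! ### The Poincaré inequality and existence of weak solutions -/

theorem norm_sq_eq (u : H10 Ω) : ‖u‖ ^ 2 = ‖H10.toL2 u‖ ^ 2 + ‖H10.grad u‖ ^ 2 :=
  WithLp.prod_norm_sq_eq_of_L2 (u : PairSpace Ω)

/-- A non-strict inequality between continuous functions extends from test functions to `H¹₀(Ω)`. -/
theorem le_of_forall_testPairs {f g : PairSpace Ω → ℝ} (hf : Continuous f) (hg : Continuous g)
    (h : ∀ p ∈ testPairs Ω, f p ≤ g p) (u : H10 Ω) : f u ≤ g u :=
  closure_minimal (t := {p | f p ≤ g p}) h (isClosed_le hf hg) u.2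

theorem continuous_pair_fst : Continuous fun p : PairSpace Ω => p.fst :=
  (WithLp.fstL 2 ℝ (L2 Ω) (L2Vec Ω)).continuous

theorem continuous_pair_snd : Continuous fun p : PairSpace Ω => p.snd :=
  (WithLp.sndL 2 ℝ (L2 Ω) (L2Vec Ω)).continuous

theorem exists_norm_le_of_isBounded (hΩ : Bornology.IsBounded Ω) :
    ∃ R : ℝ, 0 ≤ R ∧ ∀ x ∈ Ω, ‖x‖ ≤ R := by
  obtain ⟨R, hR⟩ := hΩ.exists_norm_le
  exact ⟨max R 0, le_max_right _ _, fun x hx => (hR x hx).trans (le_max_left _ _)⟩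

/-- The Poincaré inequality for test functions. Testing the weak gradient of `φ` with `x ↦ xᵢ φ(x)`
gives `‖φ‖² = -2 ∫ xᵢ φ ∂ᵢφ`. -/
theorem poincare_testPairs (hΩ : MeasurableSet Ω) (i : Fin n) {R : ℝ} (hR0 : 0 ≤ R)
    (hR : ∀ x ∈ Ω, ‖x‖ ≤ R)
    {p : PairSpace Ω} (hp : p ∈ testPairs Ω) : ‖p.fst‖ ≤ 2 * R * ‖p.snd‖ := by
  have hwg := isWeakGradient_of_mem_testPairs hp
  obtain ⟨φ, hφ, h1, h2⟩ := hp
  have hcoord : ContDiff ℝ ∞ fun x : EuclideanSpace ℝ (Fin n) => x i :=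
    (EuclideanSpace.proj (𝕜 := ℝ) i).contDiff
  have hψ : IsTest Ω (fun x => x i * φ x) := ⟨hcoord.mul hφ.1, hφ.2.mul_left,
    (tsupport_mul_subset_right).trans hφ.3⟩
  have hgrad : ∀ x, gradient (fun x : EuclideanSpace ℝ (Fin n) => x i * φ x) x i
      = φ x + x i * gradient φ x i := by
    intro x
    have e : HasFDerivAt (fun x : EuclideanSpace ℝ (Fin n) => x i)
      (EuclideanSpace.proj (𝕜 := ℝ) i : EuclideanSpace ℝ (Fin n) →L[ℝ] ℝ) x :=
      (EuclideanSpace.proj (𝕜 := ℝ) i).hasFDerivAt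
    have e' := (e.fun_mul (hφ.1.differentiable (by simp) x).hasFDerivAt).fderiv
    rw [IsTest.gradient_apply, IsTest.gradient_apply, e']
    simp [add_comm]
  have hm : MemLp (fun x => (x i * φ x) • EuclideanSpace.single i (1 : ℝ)) 2
      (volume.restrict Ω) :=
    (Continuous.memLp_of_hasCompactSupport (hψ.1.continuous.smul continuous_const)
      hψ.2.smul_right).restrict Ω
  set P : L2Vec Ω := hm.toLp with hP
  have hPn : ‖P‖ ≤ R * ‖p.fst‖ := by
    refine Lp.norm_le_mul_norm_of_ae_le_mul ?_
    filter_upwards [hm.coeFn_toLp, h1, ae_restrict_mem hΩ] with x h3 h4 h5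
    rw [h3, h4, norm_smul, norm_mul]
    have : ‖x i‖ ≤ R := (PiLp.norm_apply_le x i).trans (hR x h5)
    simpa using mul_le_mul_of_nonneg_right this (norm_nonneg (φ x))
  have hin : inner ℝ P p.snd = ∫ x in Ω, p.snd x i * (x i * φ x) := by
    rw [L2.inner_def]
    refine integral_congr_ae ?_
    filter_upwards [hm.coeFn_toLp] with x hx
    rw [hx, inner_smul_left, EuclideanSpace.inner_single_left]
    simp [mul_comm]
  have hIP := L2.integrable_inner (𝕜 := ℝ) P p.snd
  have hI1 := L2.integrable_inner (𝕜 := ℝ) p.fst p.fst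
  have e1 : ∫ x in Ω, p.fst x * gradient (fun x : EuclideanSpace ℝ (Fin n) => x i * φ x) x i
      = ‖p.fst‖ ^ 2 + inner ℝ P p.snd := by
    rw [← real_inner_self_eq_norm_sq, L2.inner_def, L2.inner_def, ← integral_add hI1 hIP]
    refine integral_congr_ae ?_
    filter_upwards [hm.coeFn_toLp, h1, h2] with x h3 h4 h5
    rw [h3, h4, h5, inner_smul_left, EuclideanSpace.inner_single_left, hgrad]
    simp
    ring
  have e2 := hwg _ hψ i
  rw [e1, ← hin] at e2
  have e3 : ‖p.fst‖ ^ 2 ≤ 2 * (R * ‖p.fst‖ * ‖p.snd‖) := by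
    have := (abs_le.1 (abs_real_inner_le_norm P p.snd)).1
    have := mul_le_mul_of_nonneg_right hPn (norm_nonneg p.snd)
    linarith
  by_cases h0 : ‖p.fst‖ = 0
  · rw [h0]; positivity
  · have : 0 < ‖p.fst‖ := lt_of_le_of_ne (norm_nonneg _) (Ne.symm h0)
    refine le_of_mul_le_mul_left ?_ this
    linarith

theorem exists_poincare (hn : 0 < n) (hΩ : MeasurableSet Ω) (hb : Bornology.IsBounded Ω) :
    ∃ C : ℝ, 0 ≤ C ∧ ∀ u : H10 Ω, ‖H10.toL2 u‖ ≤ C * ‖H10.grad u‖ := by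
  obtain ⟨R, hR0, hR⟩ := exists_norm_le_of_isBounded hb
  exact ⟨2 * R, by positivity, fun u => le_of_forall_testPairs continuous_pair_fst.norm
    (continuous_const.mul continuous_pair_snd.norm)
    (fun p hp => poincare_testPairs hΩ ⟨0, hn⟩ hR0 hR hp) u⟩

/-- By the Poincaré inequality, the gradient norm controls the `H¹` norm on `H¹₀(Ω)`. -/
theorem exists_norm_sq_le (hn : 0 < n) (hΩ : MeasurableSet Ω) (hb : Bornology.IsBounded Ω) :
    ∃ K : ℝ, 0 < K ∧ ∀ u : H10 Ω, ‖u‖ ^ 2 ≤ K * ‖H10.grad u‖ ^ 2 := by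
  obtain ⟨C, hC, h⟩ := exists_poincare hn hΩ hb
  refine ⟨C ^ 2 + 1, by positivity, fun u => ?_⟩
  have := pow_le_pow_left₀ (norm_nonneg _) (h u) 2
  rw [norm_sq_eq]
  linarith [mul_pow C ‖H10.grad u‖ 2]

/-- `u ↦ u` as a bounded operator `H¹₀(Ω) → L²(Ω)`. -/
noncomputable def toL2L : H10 Ω →L[ℝ] L2 Ω :=
  (WithLp.fstL 2 ℝ (L2 Ω) (L2Vec Ω)).comp (H10 Ω).subtypeL

/-- `u ↦ ∇u` as a bounded operator `H¹₀(Ω) → L²(Ω; ℝⁿ)`. -/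
noncomputable def gradL : H10 Ω →L[ℝ] L2Vec Ω :=
  (WithLp.sndL 2 ℝ (L2 Ω) (L2Vec Ω)).comp (H10 Ω).subtypeL

theorem grad_sub (u v : H10 Ω) : H10.grad (u - v) = H10.grad u - H10.grad v :=
  map_sub gradL u v

instance : CompleteSpace (H10 Ω) :=
  (Submodule.isClosed_topologicalClosure (testPairs Ω)).completeSpace_coe

theorem isWeakSolution_iff (h : BoundedCoercive Ω lo hi A) {z : L2 Ω} {u : H10 Ω} :
    IsWeakSolution Ω A z u ↔
      ∀ v : H10 Ω, inner ℝ (h.mulL (H10.grad u)) (H10.grad v) = inner ℝ z (H10.toL2 v) := by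
  refine forall_congr' fun v => ?_
  rw [h.inner_mulL, L2.inner_def]
  simp only [RCLike.inner_apply, conj_trivial, mul_comm]

/-- Existence and uniqueness of the weak solution, by the Lax–Milgram theorem. -/
theorem existsUnique_isWeakSolution (hn : 0 < n) (hΩ : MeasurableSet Ω)
    (hb : Bornology.IsBounded Ω) (hlo : 0 < lo) (h : BoundedCoercive Ω lo hi A) (z : L2 Ω) :
    ∃! u : H10 Ω, IsWeakSolution Ω A z u := by
  obtain ⟨K, hK, hKu⟩ := exists_norm_sq_le hn hΩ hb
  let B : H10 Ω →L[ℝ] H10 Ω →L[ℝ] ℝ :=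
    ((innerSL ℝ (E := L2Vec Ω)).bilinearComp (h.mulL.comp gradL) gradL)
  have hB : ∀ u v, B u v = inner ℝ (h.mulL (H10.grad u)) (H10.grad v) := fun _ _ => rfl
  have hc : IsCoercive B := by
    refine ⟨lo / K, by positivity, fun u => ?_⟩
    rw [hB]
    refine le_trans ?_ (h.le_inner_mulL _)
    rw [mul_assoc, ← sq, div_mul_eq_mul_div, div_le_iff₀ hK, mul_assoc]
    have := hKu u
    rw [mul_comm (‖H10.grad u‖ ^ 2)]
    gcongr
  let T := hc.continuousLinearEquivOfBilin
  let f : H10 Ω := (InnerProductSpace.toDual ℝ (H10 Ω)).symm ((innerSL ℝ z).comp toL2L)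
  have hf : ∀ v : H10 Ω, inner ℝ f v = inner ℝ z (H10.toL2 v) := fun v =>
    InnerProductSpace.toDual_symm_apply
  have hT : ∀ u : H10 Ω, IsWeakSolution Ω A z u ↔ T u = f := by
    intro u
    rw [isWeakSolution_iff h]
    refine Iff.trans (forall_congr' fun v => ?_) (ext_iff_inner_right ℝ).symm
    rw [hf, ← hB, hc.continuousLinearEquivOfBilin_apply]
  refine ⟨T.symm f, (hT _).2 (T.apply_symm_apply f), fun u hu => ?_⟩
  rw [← (hT u).1 hu, T.symm_apply_apply]

/-! ### Translations of test functions -/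

/-- The gradient of a test function vanishes off `Ω`, so its norms on `ℝⁿ` and on `Ω` agree. -/
theorem eLpNorm_gradient_eq {p : PairSpace Ω} {φ : EuclideanSpace ℝ (Fin n) → ℝ}
    (hφ : IsTest Ω φ) (h2 : p.snd =ᵐ[volume.restrict Ω] gradient φ) :
    eLpNorm (gradient φ) 2 volume = ENNReal.ofReal ‖p.snd‖ := by
  have hz : ∀ x, x ∉ Ω → gradient φ x = 0 := fun x hx => by
    have : fderiv ℝ φ x = 0 := image_eq_zero_of_notMem_tsupport
      fun h => hx (hφ.3 (tsupport_fderiv_subset ℝ h))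
    simp [gradient, this]
  rw [Lp.norm_def, ENNReal.ofReal_toReal (Lp.eLpNorm_ne_top _), eLpNorm_congr_ae h2,
    eLpNorm_restrict_eq_of_support_subset]
  exact fun x hx => by_contra fun h => hx (hz x h)

theorem IsTest.continuous_gradient {φ : EuclideanSpace ℝ (Fin n) → ℝ} (hφ : IsTest Ω φ) :
    Continuous (gradient φ) :=
  (InnerProductSpace.toDual ℝ _).symm.continuous.comp (hφ.1.continuous_fderiv (by simp))

theorem IsTest.exists_fderiv_bound {φ : EuclideanSpace ℝ (Fin n) → ℝ} (hφ : IsTest Ω φ) :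
    ∃ C, ∀ x, ‖fderiv ℝ φ x‖ ≤ C :=
  (hφ.2.fderiv ℝ).exists_bound_of_continuous (hφ.1.continuous_fderiv (by simp))

theorem IsTest.exists_bound {φ : EuclideanSpace ℝ (Fin n) → ℝ} (hφ : IsTest Ω φ) :
    ∃ C, ∀ x, ‖φ x‖ ≤ C :=
  hφ.2.exists_bound_of_continuous hφ.1.continuous

theorem integrable_coeFn_L2 [IsFiniteMeasure (volume.restrict Ω)] (g : L2 Ω) :
    Integrable g (volume.restrict Ω) :=
  (Lp.memLp g).integrable (by norm_num)

/-- Pairing `g` with the directional derivative of a translated test function: the translation may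
move the support out of `Ω`, so the bound uses the norm of `∇φ` on all of `ℝⁿ`. -/
theorem abs_integral_mul_fderiv_translate_le (g : L2 Ω) {p : PairSpace Ω}
    {φ : EuclideanSpace ℝ (Fin n) → ℝ} (hφ : IsTest Ω φ)
    (h2 : p.snd =ᵐ[volume.restrict Ω] gradient φ) (y w : EuclideanSpace ℝ (Fin n)) :
    |∫ x in Ω, g x * fderiv ℝ φ (x - w) y| ≤ ‖y‖ * ‖g‖ * ‖p.snd‖ := by
  have hmp := measurePreserving_sub_right (volume : Measure (EuclideanSpace ℝ (Fin n))) w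
  have hN : eLpNorm (fun x => gradient φ (x - w)) 2 volume = ENNReal.ofReal ‖p.snd‖ := by
    rw [← eLpNorm_gradient_eq hφ h2]
    exact eLpNorm_comp_measurePreserving hφ.continuous_gradient.aestronglyMeasurable hmp
  have hm : MemLp (fun x => gradient φ (x - w)) 2 (volume.restrict Ω) := by
    refine MemLp.restrict Ω ⟨?_, by rw [hN]; exact ENNReal.ofReal_lt_top⟩
    exact (hφ.continuous_gradient.comp (continuous_id.sub continuous_const)).aestronglyMeasurable
  have hn : ‖hm.toLp‖ ≤ ‖p.snd‖ := by
    rw [Lp.norm_toLp]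
    refine ENNReal.toReal_le_of_le_ofReal (norm_nonneg _) ?_
    rw [← hN]
    exact eLpNorm_mono_measure _ Measure.restrict_le_self
  have hb : ∀ x, ‖fderiv ℝ φ (x - w) y‖ ≤ ‖y‖ * ‖gradient φ (x - w)‖ := fun x => by
    rw [gradient, LinearIsometryEquiv.norm_map, mul_comm]
    exact (fderiv ℝ φ (x - w)).le_opNorm y
  have hm' : MemLp (fun x => fderiv ℝ φ (x - w) y) 2 (volume.restrict Ω) := by
    refine hm.of_le_mul ?_ (Eventually.of_forall hb)
    exact (((hφ.1.continuous_fderiv (by simp)).comp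
      (continuous_id.sub continuous_const)).clm_apply continuous_const).aestronglyMeasurable
  have hn' : ‖hm'.toLp‖ ≤ ‖y‖ * ‖p.snd‖ := by
    refine le_trans (Lp.norm_le_mul_norm_of_ae_le_mul (g := hm.toLp) (c := ‖y‖) ?_) (by gcongr)
    filter_upwards [hm.coeFn_toLp, hm'.coeFn_toLp] with x h3 h4
    rw [h3, h4]
    exact hb x
  have e : ∫ x in Ω, g x * fderiv ℝ φ (x - w) y = inner ℝ g hm'.toLp := by
    rw [L2.inner_def]
    refine integral_congr_ae ?_
    filter_upwards [hm'.coeFn_toLp] with x hx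
    rw [hx]
    simp [mul_comm]
  rw [e]
  refine (abs_real_inner_le_norm _ _).trans ?_
  calc ‖g‖ * ‖hm'.toLp‖ ≤ ‖g‖ * (‖y‖ * ‖p.snd‖) := by gcongr
    _ = ‖y‖ * ‖g‖ * ‖p.snd‖ := by ring

/-- Translation estimate in weak form: `|⟨g, φ(· - y) - φ⟩| ≤ |y| ‖g‖ ‖∇φ‖`. It is the mean value
inequality for `t ↦ ⟨g, φ(· - t y)⟩`. -/
theorem abs_integral_translate_sub_le [IsFiniteMeasure (volume.restrict Ω)] (g : L2 Ω)
    {p : PairSpace Ω} {φ : EuclideanSpace ℝ (Fin n) → ℝ} (hφ : IsTest Ω φ)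
    (h2 : p.snd =ᵐ[volume.restrict Ω] gradient φ) (y : EuclideanSpace ℝ (Fin n)) :
    |(∫ x in Ω, g x * φ (x - y)) - ∫ x in Ω, g x * φ x| ≤ ‖y‖ * ‖g‖ * ‖p.snd‖ := by
  obtain ⟨C, hC⟩ := hφ.exists_fderiv_bound
  obtain ⟨C', hC'⟩ := hφ.exists_bound
  have hg := integrable_coeFn_L2 g
  have hcont : ∀ t : ℝ, Continuous fun x : EuclideanSpace ℝ (Fin n) => x - t • y := fun t => by
    fun_prop
  have hd : ∀ t : ℝ, HasDerivAt (fun t : ℝ => ∫ x in Ω, g x * φ (x - t • y))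
      (∫ x in Ω, g x * fderiv ℝ φ (x - t • y) (-y)) t := by
    intro t
    refine (hasDerivAt_integral_of_dominated_loc_of_deriv_le
      (F := fun (t : ℝ) x => g x * φ (x - t • y))
      (F' := fun (t : ℝ) x => g x * fderiv ℝ φ (x - t • y) (-y))
      (bound := fun x => ‖g x‖ * (C * ‖y‖)) (s := univ) univ_mem ?_ ?_ ?_ ?_ ?_ ?_).2
    · exact Eventually.of_forall fun t => hg.aestronglyMeasurable.mul
        (hφ.1.continuous.comp (hcont t)).aestronglyMeasurable
    · exact hg.mul_bdd (hφ.1.continuous.comp (hcont t)).aestronglyMeasurable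
        (Eventually.of_forall fun x => hC' _)
    · exact hg.aestronglyMeasurable.mul ((((hφ.1.continuous_fderiv (by simp)).comp
        (hcont t)).clm_apply continuous_const).aestronglyMeasurable)
    · refine Eventually.of_forall fun x s _ => ?_
      rw [norm_mul]
      have := (fderiv ℝ φ (x - s • y)).le_of_opNorm_le (hC _) (-y)
      rw [norm_neg] at this
      gcongr
    · exact hg.norm.mul_const _
    · refine Eventually.of_forall fun x s _ => HasDerivAt.const_mul _ ?_
      have hl : HasDerivAt (fun s : ℝ => x - s • y) (-y) s := by
        simpa using ((hasDerivAt_id s).smul_const y).const_sub x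
      exact (hφ.1.differentiable (by simp) (x - s • y)).hasFDerivAt.comp_hasDerivAt s hl
  have := norm_image_sub_le_of_norm_deriv_le_segment_01' (C := ‖y‖ * ‖g‖ * ‖p.snd‖)
    (fun t _ => (hd t).hasDerivWithinAt) (fun t _ => by
      simpa using abs_integral_mul_fderiv_translate_le g hφ h2 (-y) (t • y))
  simpa using this

/-! ### Ball averages and the negative norm -/

/-- The unnormalised ball average `w ↦ ∫_{Ω ∩ B(w, δ)} g`, that is, the convolution of `g` with the
indicator function of `B(0, δ)`. -/
noncomputable def ballIntegral (δ : ℝ) (g : L2 Ω) (w : EuclideanSpace ℝ (Fin n)) : ℝ :=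
  ∫ x in Ω, indicator (Metric.ball w δ) g x

theorem ballIntegral_eq_inner [IsFiniteMeasure (volume.restrict Ω)] (δ : ℝ) (g : L2 Ω)
    (w : EuclideanSpace ℝ (Fin n)) :
    ballIntegral δ g w = inner ℝ (indicatorConstLp 2 (Metric.isOpen_ball.measurableSet :
      MeasurableSet (Metric.ball w δ)) (measure_ne_top (volume.restrict Ω) _) (1 : ℝ)) g := by
  rw [L2.inner_indicatorConstLp_one, ballIntegral,
    integral_indicator Metric.isOpen_ball.measurableSet]

theorem abs_ballIntegral_le [IsFiniteMeasure (volume.restrict Ω)] (δ : ℝ) (g : L2 Ω)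
    (w : EuclideanSpace ℝ (Fin n)) :
    |ballIntegral δ g w| ≤ (volume.restrict Ω).real univ ^ (1 / 2 : ℝ) * ‖g‖ := by
  rw [ballIntegral_eq_inner]
  refine (abs_real_inner_le_norm _ _).trans ?_
  rw [norm_indicatorConstLp (by simp) (by simp)]
  simp only [norm_one, one_mul, ENNReal.toReal_ofNat]
  gcongr
  · exact measure_ne_top _ _
  · exact subset_univ _

/-- The measurable kernel behind `ballIntegral`. -/
theorem stronglyMeasurable_ballKernel (δ : ℝ) (g : L2 Ω) :
    StronglyMeasurable (Function.uncurry fun w x : EuclideanSpace ℝ (Fin n) =>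
      indicator (Metric.ball w δ) g x) := by
  have hs : MeasurableSet {q : EuclideanSpace ℝ (Fin n) × EuclideanSpace ℝ (Fin n) |
      dist q.2 q.1 < δ} := (isOpen_lt (by fun_prop) continuous_const).measurableSet
  have := ((Lp.stronglyMeasurable g).comp_measurable (measurable_snd (α :=
    EuclideanSpace ℝ (Fin n)) (β := EuclideanSpace ℝ (Fin n)))).indicator hs
  convert this using 1
  ext ⟨w, x⟩
  simp [indicator, Function.uncurry]

theorem stronglyMeasurable_ballIntegral (δ : ℝ) (g : L2 Ω) :
    StronglyMeasurable (ballIntegral δ g) :=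
  (stronglyMeasurable_ballKernel δ g).integral_prod_right

theorem memLp_ballIntegral [IsFiniteMeasure (volume.restrict Ω)] (δ : ℝ) (g : L2 Ω) :
    MemLp (ballIntegral δ g) 2 (volume.restrict Ω) :=
  MemLp.of_bound (stronglyMeasurable_ballIntegral δ g).aestronglyMeasurable _
    (Eventually.of_forall (abs_ballIntegral_le δ g))

/-- Fubini: averaging the translates of `φ` over `B(0, δ)` moves the average onto `g`. -/
theorem integral_ball_translate [IsFiniteMeasure (volume.restrict Ω)] (δ : ℝ) (g : L2 Ω)
    {φ : EuclideanSpace ℝ (Fin n) → ℝ} (hφ : IsTest Ω φ) :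
    ∫ y in Metric.ball 0 δ, ∫ x in Ω, g x * φ (x - y)
      = ∫ w in Ω, φ w * ballIntegral δ g w := by
  obtain ⟨C, hC⟩ := hφ.exists_bound
  have hg := integrable_coeFn_L2 g
  have hball : IsFiniteMeasure
      (volume.restrict (Metric.ball (0 : EuclideanSpace ℝ (Fin n)) δ)) :=
    ⟨by simpa using measure_ball_lt_top⟩
  have hφ0 : ∀ w, w ∉ Ω → φ w = 0 := fun w hw =>
    image_eq_zero_of_notMem_tsupport fun h => hw (hφ.3 h)
  rw [integral_integral_swap]
  · have e : ∀ x, ∫ y in Metric.ball 0 δ, g x * φ (x - y)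
        = ∫ w in Ω, φ w * indicator (Metric.ball w δ) g x := by
      intro x
      rw [← integral_indicator Metric.isOpen_ball.measurableSet,
        ← integral_sub_left_eq_self _ volume x,
        setIntegral_eq_integral_of_forall_compl_eq_zero (fun w hw => by simp [hφ0 w hw])]
      refine integral_congr_ae (Eventually.of_forall fun w => ?_)
      by_cases hw : dist x w < δ
      · have h1 : x - w ∈ Metric.ball 0 δ := by simpa [dist_eq_norm] using hw
        have h2 : x ∈ Metric.ball w δ := hw
        simp [indicator_of_mem h1, indicator_of_mem h2, mul_comm]
      · have h1 : x - w ∉ Metric.ball 0 δ := by simpa [dist_eq_norm] using hw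
        have h2 : x ∉ Metric.ball w δ := hw
        simp [indicator_of_notMem h1, indicator_of_notMem h2]
    simp_rw [e]
    rw [integral_integral_swap]
    · simp_rw [integral_const_mul]
      rfl
    · have hk := (stronglyMeasurable_ballKernel δ g).comp_measurable
        (measurable_swap (α := EuclideanSpace ℝ (Fin n)) (β := EuclideanSpace ℝ (Fin n)))
      refine Integrable.mono (hg.mul_prod (integrable_const C)) (AEStronglyMeasurable.mul
        (hφ.1.continuous.comp continuous_snd).aestronglyMeasurable hk.aestronglyMeasurable) ?_
      refine Eventually.of_forall fun q => ?_
      simp only [Function.uncurry, norm_mul, mul_comm ‖φ q.2‖]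
      have := (hC q.2).trans (le_abs_self C)
      have h' := norm_indicator_le_norm_self g q.1 (s := Metric.ball q.2 δ)
      exact mul_le_mul h' this (norm_nonneg _) (norm_nonneg _)
  · have := (hg.mul_prod (ν := volume.restrict (Metric.ball (0 : EuclideanSpace ℝ (Fin n)) δ))
      (integrable_const (1 : ℝ)))
    simp only [mul_one] at this
    refine Integrable.swap (f := fun q : EuclideanSpace ℝ (Fin n) × EuclideanSpace ℝ (Fin n) =>
      g q.1 * φ (q.1 - q.2)) ?_
    exact this.mul_bdd (hφ.1.continuous.comp
      (continuous_fst.sub continuous_snd)).aestronglyMeasurable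
      (Eventually.of_forall fun q => hC _)

/-- The negative norm of `g` is at most `δ ‖g‖` plus the norm of the ball averages of `g`: this
replaces the compact embedding of `H¹₀(Ω)` in `L²(Ω)`. -/
theorem abs_inner_le_of_mem_testPairs [IsFiniteMeasure (volume.restrict Ω)] {δ : ℝ} (hδ : 0 < δ)
    (g : L2 Ω) {p : PairSpace Ω} (hp : p ∈ testPairs Ω) :
    |inner ℝ g p.fst| ≤ δ * ‖g‖ * ‖p.snd‖
      + (volume.real (Metric.ball (0 : EuclideanSpace ℝ (Fin n)) δ))⁻¹
        * ‖(memLp_ballIntegral δ g).toLp‖ * ‖p.fst‖ := by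
  obtain ⟨φ, hφ, h1, h2⟩ := hp
  set V := volume.real (Metric.ball (0 : EuclideanSpace ℝ (Fin n)) δ) with hV
  have hVpos : 0 < V := ENNReal.toReal_pos (Metric.measure_ball_pos _ _ hδ).ne'
    measure_ball_lt_top.ne
  have hball : IsFiniteMeasure
      (volume.restrict (Metric.ball (0 : EuclideanSpace ℝ (Fin n)) δ)) :=
    ⟨by simpa using measure_ball_lt_top⟩
  obtain ⟨C, hC⟩ := hφ.exists_bound
  have hg := integrable_coeFn_L2 g
  let h : EuclideanSpace ℝ (Fin n) → ℝ := fun y => ∫ x in Ω, g x * φ (x - y)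
  have hh : Continuous h := by
    refine continuous_of_dominated (bound := fun x => ‖g x‖ * C) ?_ ?_ (hg.norm.mul_const C) ?_
    · exact fun y => hg.aestronglyMeasurable.mul
        (hφ.1.continuous.comp (continuous_id.sub continuous_const)).aestronglyMeasurable
    · refine fun y => Eventually.of_forall fun x => ?_
      rw [norm_mul]
      gcongr
      exact hC _
    · exact Eventually.of_forall fun x => continuous_const.mul
        (hφ.1.continuous.comp (continuous_const.sub continuous_id))
  have e0 : inner ℝ g p.fst = ∫ x in Ω, g x * φ x := by
    rw [L2.inner_def]
    refine integral_congr_ae ?_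
    filter_upwards [h1] with x hx
    rw [hx]
    simp [mul_comm]
  have hdiff : ∀ y, |h y - inner ℝ g p.fst| ≤ ‖y‖ * ‖g‖ * ‖p.snd‖ := fun y => by
    rw [e0]
    exact abs_integral_translate_sub_le g hφ h2 y
  have hint : IntegrableOn h (Metric.ball 0 δ) :=
    (hh.continuousOn.integrableOn_compact (isCompact_closedBall 0 δ)).mono_set
      Metric.ball_subset_closedBall
  have hsub : |(∫ y in Metric.ball 0 δ, h y) - V * inner ℝ g p.fst|
      ≤ (δ * ‖g‖ * ‖p.snd‖) * V := by
    have e : V * inner ℝ g p.fst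
        = ∫ _ in Metric.ball (0 : EuclideanSpace ℝ (Fin n)) δ, inner ℝ g p.fst := by
      rw [setIntegral_const, smul_eq_mul]
    rw [e, ← integral_sub hint (integrable_const _)]
    have hbd : ∀ y ∈ Metric.ball (0 : EuclideanSpace ℝ (Fin n)) δ,
        ‖h y - inner ℝ g p.fst‖ ≤ δ * ‖g‖ * ‖p.snd‖ := fun y hy => by
      refine (hdiff y).trans ?_
      have : ‖y‖ ≤ δ := (mem_ball_zero_iff.1 hy).le
      gcongr
    exact norm_setIntegral_le_of_norm_le_const (μ := volume) measure_ball_lt_top hbd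
  have havg : |∫ y in Metric.ball 0 δ, h y| ≤ ‖(memLp_ballIntegral δ g).toLp‖ * ‖p.fst‖ := by
    have e : ∫ y in Metric.ball 0 δ, h y = inner ℝ (memLp_ballIntegral δ g).toLp p.fst := by
      rw [integral_ball_translate δ g hφ, L2.inner_def]
      refine integral_congr_ae ?_
      filter_upwards [h1, (memLp_ballIntegral δ g).coeFn_toLp] with x hx hx'
      rw [hx, hx']
      simp
    rw [e]
    exact abs_real_inner_le_norm _ _
  have : V * |inner ℝ g p.fst| ≤ (δ * ‖g‖ * ‖p.snd‖) * V
      + ‖(memLp_ballIntegral δ g).toLp‖ * ‖p.fst‖ := by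
    rw [← abs_of_pos hVpos, ← abs_mul, abs_of_pos hVpos]
    rw [abs_sub_comm] at hsub
    have := abs_sub_abs_le_abs_sub (V * inner ℝ g p.fst) (∫ y in Metric.ball 0 δ, h y)
    linarith
  rw [← mul_le_mul_iff_right₀ hVpos]
  refine this.trans (le_of_eq ?_)
  field_simp

theorem abs_inner_toL2_le [IsFiniteMeasure (volume.restrict Ω)] {δ : ℝ} (hδ : 0 < δ)
    (g : L2 Ω) (u : H10 Ω) :
    |inner ℝ g (H10.toL2 u)| ≤ (δ * ‖g‖
      + (volume.real (Metric.ball (0 : EuclideanSpace ℝ (Fin n)) δ))⁻¹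
        * ‖(memLp_ballIntegral δ g).toLp‖) * ‖u‖ := by
  have := le_of_forall_testPairs (continuous_const.inner continuous_pair_fst).abs
    ((continuous_const.mul continuous_pair_snd.norm).add
      (continuous_const.mul continuous_pair_fst.norm))
    (fun p hp => abs_inner_le_of_mem_testPairs hδ g hp) u
  refine (show _ ≤ δ * ‖g‖ * ‖(u : PairSpace Ω).snd‖
    + (volume.real (Metric.ball (0 : EuclideanSpace ℝ (Fin n)) δ))⁻¹
      * ‖(memLp_ballIntegral δ g).toLp‖ * ‖(u : PairSpace Ω).fst‖ from this).trans ?_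
  have h1 : ‖(u : PairSpace Ω).fst‖ ≤ ‖u‖ := by
    refine le_of_sq_le_sq ?_ (norm_nonneg _)
    rw [norm_sq_eq]
    exact le_add_of_nonneg_right (sq_nonneg _)
  have h2 : ‖(u : PairSpace Ω).snd‖ ≤ ‖u‖ := by
    refine le_of_sq_le_sq ?_ (norm_nonneg _)
    rw [norm_sq_eq]
    exact le_add_of_nonneg_left (sq_nonneg _)
  rw [add_mul]
  gcongr

theorem tendsto_norm_ballIntegral [IsFiniteMeasure (volume.restrict Ω)] (δ : ℝ) {g : ℕ → L2 Ω}
    {M : ℝ} (hM : ∀ k, ‖g k‖ ≤ M)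
    (hg : ∀ f : L2 Ω, Tendsto (fun k => inner ℝ f (g k)) atTop (𝓝 0)) :
    Tendsto (fun k => ‖(memLp_ballIntegral δ (g k)).toLp‖) atTop (𝓝 0) := by
  set c := (volume.restrict Ω).real univ ^ (1 / 2 : ℝ)
  have key : Tendsto (fun k => ‖(memLp_ballIntegral δ (g k)).toLp‖ ^ 2) atTop (𝓝 0) := by
    have e : ∀ k, ‖(memLp_ballIntegral δ (g k)).toLp‖ ^ 2
        = ∫ w in Ω, ballIntegral δ (g k) w ^ 2 := by
      intro k
      rw [← real_inner_self_eq_norm_sq, L2.inner_def]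
      refine integral_congr_ae ?_
      filter_upwards [(memLp_ballIntegral δ (g k)).coeFn_toLp] with x hx
      rw [hx, real_inner_self_eq_norm_sq, Real.norm_eq_abs, sq_abs]
    simp_rw [e]
    have := tendsto_integral_of_dominated_convergence (μ := volume.restrict Ω)
      (F := fun k w => ballIntegral δ (g k) w ^ 2) (f := fun _ => (0 : ℝ)) (fun _ => (c * M) ^ 2)
      (fun k => ((stronglyMeasurable_ballIntegral δ (g k)).pow 2).aestronglyMeasurable)
      (integrable_const _)
      (fun k => Eventually.of_forall fun w => by
        rw [norm_pow, Real.norm_eq_abs]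
        have h1 := abs_ballIntegral_le δ (g k) w
        have h2 : c * ‖g k‖ ≤ c * M := mul_le_mul_of_nonneg_left (hM k)
          (Real.rpow_nonneg measureReal_nonneg _)
        exact pow_le_pow_left₀ (abs_nonneg _) (h1.trans h2) 2)
      (Eventually.of_forall fun w => by
        simp_rw [ballIntegral_eq_inner]
        simpa using (hg _).pow 2)
    simpa using this
  simpa using key.sqrt

/-- Weak convergence in `L²(Ω)` implies convergence in the dual norm of `H¹₀(Ω)`. -/
theorem eventually_abs_inner_toL2_le [IsFiniteMeasure (volume.restrict Ω)] {g : ℕ → L2 Ω}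
    (hg : ∀ f : L2 Ω, Tendsto (fun k => inner ℝ f (g k)) atTop (𝓝 0)) {η : ℝ} (hη : 0 < η) :
    ∀ᶠ k in atTop, ∀ u : H10 Ω, |inner ℝ (g k) (H10.toL2 u)| ≤ η * ‖u‖ := by
  -- a weakly convergent sequence is bounded, by the uniform boundedness principle
  obtain ⟨M, hM⟩ : ∃ M, ∀ k, ‖g k‖ ≤ M := by
    obtain ⟨M, hM⟩ := banach_steinhaus (g := fun k => innerSL ℝ (g k)) fun f => by
      obtain ⟨C, hC⟩ := (hg f).norm.bddAbove_range
      refine ⟨C, fun k => ?_⟩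
      rw [innerSL_apply_apply, real_inner_comm]
      exact hC ⟨k, rfl⟩
    exact ⟨M, fun k => by simpa using hM k⟩
  have hM0 : 0 ≤ M := (norm_nonneg _).trans (hM 0)
  set δ := η / (2 * (M + 1))
  have hδ : 0 < δ := by positivity
  have hδM : δ * M ≤ η / 2 := by
    rw [div_mul_eq_mul_div, div_le_div_iff₀ (by positivity) (by positivity)]
    nlinarith
  have ht := (tendsto_norm_ballIntegral δ hM hg).const_mul
    (volume.real (Metric.ball (0 : EuclideanSpace ℝ (Fin n)) δ))⁻¹
  rw [mul_zero] at ht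
  filter_upwards [ht.eventually_lt_const (half_pos hη)] with k hk u
  refine (abs_inner_toL2_le hδ (g k) u).trans ?_
  have : δ * ‖g k‖ ≤ δ * M := by gcongr; exact hM k
  gcongr
  linarith

/-! ### Convergence of the solutions -/

theorem tendsto_inner_of_tendsto_weakSpace {ι : Type*} {l : Filter ι} {g : ι → L2 Ω} {z : L2 Ω}
    (h : Tendsto (fun k => toWeakSpace ℝ (L2 Ω) (g k)) l (𝓝 (toWeakSpace ℝ (L2 Ω) z)))
    (f : L2 Ω) : Tendsto (fun k => inner ℝ f (g k)) l (𝓝 (inner ℝ f z)) :=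
  ((WeakBilin.eval_continuous (topDualPairing ℝ (L2 Ω)).flip (innerSL ℝ f)).tendsto _).comp h

theorem isWeakSolution_solutionOp {Ξ : Type*} {a : EuclideanSpace ℝ (Fin n) → Ξ → ℝ} {ξ : Ξ}
    {z : L2 Ω} (h : ∃! u : H10 Ω, IsWeakSolution Ω (fun x => a x ξ) z u) :
    IsWeakSolution Ω (fun x => a x ξ) z (solutionOp Ω a ξ z) := by
  rw [solutionOp, dif_pos h]
  exact h.choose_spec.1

/-- Energy estimate for the difference of two solutions: test both equations with `u' - u`. -/
theorem le_of_isWeakSolution {lo hi : ℝ} {A A' : EuclideanSpace ℝ (Fin n) → ℝ}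
    (h : BoundedCoercive Ω lo hi A) (h' : BoundedCoercive Ω lo hi A') {z z' : L2 Ω} {u u' : H10 Ω}
    (hu : IsWeakSolution Ω A z u) (hu' : IsWeakSolution Ω A' z' u') :
    lo * ‖H10.grad (u' - u)‖ ^ 2 ≤ |inner ℝ (z' - z) (H10.toL2 (u' - u))|
      + ‖h'.mulL (H10.grad u) - h.mulL (H10.grad u)‖ * ‖u' - u‖ := by
  have e1 := (isWeakSolution_iff h).1 hu (u' - u)
  have e2 := (isWeakSolution_iff h').1 hu' (u' - u)
  have e3 : inner ℝ (h'.mulL (H10.grad (u' - u))) (H10.grad (u' - u))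
      = inner ℝ (z' - z) (H10.toL2 (u' - u))
        - inner ℝ (h'.mulL (H10.grad u) - h.mulL (H10.grad u)) (H10.grad (u' - u)) := by
    rw [inner_sub_left, inner_sub_left, ← e1, ← e2]
    nth_rewrite 1 [grad_sub]
    rw [map_sub, inner_sub_left]
    ring
  refine (h'.le_inner_mulL _).trans ?_
  have h2 : ‖H10.grad (u' - u)‖ ≤ ‖u' - u‖ := by
    refine le_of_sq_le_sq ?_ (norm_nonneg _)
    rw [norm_sq_eq]
    exact le_add_of_nonneg_left (sq_nonneg _)
  have h3 := (abs_le.1 (abs_real_inner_le_norm (h'.mulL (H10.grad u) - h.mulL (H10.grad u))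
    (H10.grad (u' - u)))).1
  have h4 := mul_le_mul_of_nonneg_left h2
    (norm_nonneg (h'.mulL (H10.grad u) - h.mulL (H10.grad u)))
  have h5 := le_abs_self (inner ℝ (z' - z) (H10.toL2 (u' - u)))
  rw [e3]
  linarith

/-- Weak solutions depend continuously on the data, for weak convergence of the right-hand sides
and almost everywhere convergence of the coefficients. -/
theorem tendsto_of_isWeakSolution (hn : 0 < n) (hΩ : MeasurableSet Ω)
    (hb : Bornology.IsBounded Ω) {lo hi : ℝ} (hlo : 0 < lo)
    {A : EuclideanSpace ℝ (Fin n) → ℝ} {B : ℕ → EuclideanSpace ℝ (Fin n) → ℝ}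
    (hA : BoundedCoercive Ω lo hi A) (hB : ∀ k, BoundedCoercive Ω lo hi (B k))
    (hBA : ∀ᵐ x ∂(volume.restrict Ω), Tendsto (fun k => B k x) atTop (𝓝 (A x)))
    {z : L2 Ω} {y : ℕ → L2 Ω}
    (hy : ∀ f : L2 Ω, Tendsto (fun k => inner ℝ f (y k)) atTop (𝓝 (inner ℝ f z)))
    {u : H10 Ω} {v : ℕ → H10 Ω} (hu : IsWeakSolution Ω A z u)
    (hv : ∀ k, IsWeakSolution Ω (B k) (y k) (v k)) :
    Tendsto v atTop (𝓝 u) := by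
  have hfin : IsFiniteMeasure (volume.restrict Ω) := ⟨by simpa using hb.measure_lt_top⟩
  obtain ⟨K, hK, hKu⟩ := exists_norm_sq_le hn hΩ hb
  rw [Metric.tendsto_atTop']
  intro r hr
  have hη : 0 < lo * r / (4 * K) := by positivity
  have h1 := eventually_abs_inner_toL2_le (g := fun k => y k - z) (fun f => by
    simpa [inner_sub_right] using (hy f).sub_const (inner ℝ f z)) hη
  have h2 := (tendsto_iff_norm_sub_tendsto_zero.1
    (tendsto_mulL hB hA hBA (H10.grad u))).eventually_lt_const hη
  obtain ⟨N, hN⟩ := eventually_atTop.1 (h1.and h2)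
  refine ⟨N, fun k hk => ?_⟩
  obtain ⟨h3, h4⟩ := hN k hk.le
  have h5 := le_of_isWeakSolution hA (hB k) hu (hv k)
  have h6 := h3 (v k - u)
  have h7 := hKu (v k - u)
  have h8 := mul_le_mul_of_nonneg_right h4.le (norm_nonneg (v k - u))
  rw [dist_eq_norm]
  set s := ‖v k - u‖
  have h9 : lo * s ^ 2 ≤ lo * (r / 2) * s := by
    calc lo * s ^ 2 ≤ lo * (K * ‖H10.grad (v k - u)‖ ^ 2) := by gcongr
      _ = K * (lo * ‖H10.grad (v k - u)‖ ^ 2) := by ring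
      _ ≤ K * (lo * r / (4 * K) * s + lo * r / (4 * K) * s) := by
        gcongr
        linarith
      _ = lo * (r / 2) * s := by field_simp; ring
  by_contra! hrs
  have : 0 < lo * s * (s - r / 2) := mul_pos (mul_pos hlo (hr.trans_le hrs)) (by linarith)
  linarith

end EllipticPDE

theorem proposition4p3
    {n : ℕ} (hn : 0 < n)
    (Ω : Set (EuclideanSpace ℝ (Fin n))) (hΩ_open : IsOpen Ω) (hΩ_bdd : Bornology.IsBounded Ω)
    {Ξ : Type*} [NormedAddCommGroup Ξ] [NormedSpace ℝ Ξ] [CompleteSpace Ξ]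
    [TopologicalSpace.SeparableSpace Ξ]
    (a : EuclideanSpace ℝ (Fin n) → Ξ → ℝ)
    (lo hi : ℝ) (hlo : 0 < lo)
    (zε : ℝ → EllipticPDE.L2 Ω) (z : EllipticPDE.L2 Ω)
    (hz : Tendsto (fun ε => toWeakSpace ℝ (EllipticPDE.L2 Ω) (zε ε)) (𝓝[>] 0)
      (𝓝 (toWeakSpace ℝ (EllipticPDE.L2 Ω) z)))
    (ξε : ℝ → Ξ) (ξ : Ξ) (hξ : Tendsto ξε (𝓝[>] 0) (𝓝 ξ))
    (ha : EllipticPDE.BoundedCoercive Ω lo hi (fun x => a x ξ))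
    (haε : ∀ ε > 0, EllipticPDE.BoundedCoercive Ω lo hi (fun x => a x (ξε ε)))
    (ha_cont : ∀ᵐ x ∂(volume.restrict Ω), SeqContinuous (a x)) :
    (∃! u : EllipticPDE.H10 Ω, EllipticPDE.IsWeakSolution Ω (fun x => a x ξ) z u) ∧
    (∀ ε > 0, ∃! u : EllipticPDE.H10 Ω,
      EllipticPDE.IsWeakSolution Ω (fun x => a x (ξε ε)) (zε ε) u) ∧
    Tendsto (fun ε => EllipticPDE.solutionOp Ω a (ξε ε) (zε ε)) (𝓝[>] 0)
      (𝓝 (EllipticPDE.solutionOp Ω a ξ z)) := by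
  have hm := hΩ_open.measurableSet
  have hex := EllipticPDE.existsUnique_isWeakSolution hn hm hΩ_bdd hlo ha z
  have hexε := fun ε (hε : 0 < ε) =>
    EllipticPDE.existsUnique_isWeakSolution hn hm hΩ_bdd hlo (haε ε hε) (zε ε)
  refine ⟨hex, hexε, tendsto_of_seq_tendsto fun ε hε => ?_⟩
  obtain ⟨N, hN⟩ := eventually_atTop.1 (hε.eventually self_mem_nhdsWithin)
  -- the coefficients are controlled for positive parameters only, so drop the first `N` terms
  have hpos : ∀ k, 0 < ε (k + N) := fun k => hN _ (Nat.le_add_left N k)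
  have hεN : Tendsto (fun k => ε (k + N)) atTop (𝓝[>] 0) := hε.comp (tendsto_add_atTop_nat N)
  refine (tendsto_add_atTop_iff_nat N).1 ?_
  refine EllipticPDE.tendsto_of_isWeakSolution hn hm hΩ_bdd hlo ha (fun k => haε _ (hpos k)) ?_
    (fun f => (EllipticPDE.tendsto_inner_of_tendsto_weakSpace hz f).comp hεN)
    (EllipticPDE.isWeakSolution_solutionOp hex)
    (fun k => EllipticPDE.isWeakSolution_solutionOp (hexε _ (hpos k)))
  filter_upwards [ha_cont] with x hx
  exact hx (hξ.comp hεN)
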